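/- For a Young diagram $\mu$ with $N$ cells let $d_\mu$ be the number of standard Young tableaux of shape $\mu$, and let $l^{(k)}(\mu)$ be the number of cells in the $k$-th row of $\mu$. For $k\ge 1$ and $n,N\ge 0$ put $$q^{(k)}_{n,N}=\frac1{N!}\sum_{\mu\vdash N,\ l^{(k)}(\mu)\le n} d_\mu^2 ,\qquad \phi^{(k)}_n(\lambda)=\sum_{N=0}^\infty \frac{e^{-\lambda}\lambda^N}{N!}\,q^{(k)}_{n,N}$$ (so $q^{(k)}_{n,0}=1$). Let $\lambda\ge 0$. For $n\ge 1$ let $$T_{n-1}=\Bigl(\int_0^{2\pi}e^{-i(j-k)\theta}e^{2\sqrt\lambda\cos\theta}\,\frac{d\theta}{2\pi}\Bigr)_{0\le j,k\le n-1},$$ and define $$a_0(0)=\sum_{m=0}^\infty\frac{\lambda^m}{(m!)^2},\qquad a_0(s)=\sum_{m=1}^\infty\frac{\lambda^m}{(m+s)^2((m-1)!)^2}\quad(s\ge1),$$ $$a_j(s)=\sum_{m=j}^\infty\frac{\lambda^{m-j/2}}{(m+s)\,(m-1)!\,(m-j)!}\quad(j\ge1,\ s\ge0),\qquad b_n(s)=(a_1(s),\dots,a_n(s))^T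 .$$ Then the series defining $\phi^{(1)}_n(\lambda)$ and $\phi^{(2)}_{n+1}(\lambda)$ converge for every $n\ge 0$; for every $n\ge 1$ the matrix $T_{n-1}$ is invertible and $$\phi^{(2)}_{n+1}(\lambda)=\Bigl[\sum_{s=0}^\infty\frac{\lambda^s}{(s!)^2}\Bigl(a_0(s)-\bigl(T_{n-1}^{-1}b_n(s),b_n(s)\bigr)\Bigr)\Bigr]\phi^{(1)}_n(\lambda),$$ where $(\cdot,\cdot)$ is the standard inner product and the series over $s$ converges absolutely; and for $n=0$ $$\phi^{(2)}_{1}(\lambda)=\Bigl[\sum_{s=0}^\infty\frac{\lambda^s}{(s!)^2}\,a_0(s)\Bigr]\phi^{(1)}_0(\lambda),$$ again with an absolutely convergent series. -/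

import Mathlib

namespace PlancherelSecondRow

open scoped Nat

/-- A standard Young tableau of shape `μ`: a bijective filling of the `N = μ.card` cells by
`N` labels (here `0, …, N - 1`) that increases strictly along every row (left to right) and
down every column. The cell `(i, j)` lies in row `i` and column `j`. -/
def StandardYoungTableau (μ : YoungDiagram) : Type :=
  {T : μ.cells ≃ Fin μ.card //
    (∀ c c' : μ.cells, c.1.1 = c'.1.1 → c.1.2 < c'.1.2 → T c < T c') ∧
    (∀ c c' : μ.cells, c.1.2 = c'.1.2 → c.1.1 < c'.1.1 → T c < T c')}

/-- `d_μ`, the number of standard Young tableaux of shape `μ`. -/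
noncomputable def numSYT (μ : YoungDiagram) : ℕ := Nat.card (StandardYoungTableau μ)

theorem finite_setOf_card_eq (N : ℕ) : {μ : YoungDiagram | μ.card = N}.Finite := by
  have hinj : Function.Injective YoungDiagram.cells := fun _ _ h => YoungDiagram.ext h
  refine Set.Finite.of_finite_image (f := YoungDiagram.cells) ?_ hinj.injOn
  refine (((Finset.range N ×ˢ Finset.range N).powerset).finite_toSet).subset ?_
  rintro _ ⟨μ, rfl, rfl⟩
  simp only [Finset.coe_powerset, Set.mem_preimage, Set.mem_powerset_iff, Finset.coe_subset]
  rintro ⟨i, j⟩ hc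
  have hc' : (i, j) ∈ μ := hc
  rw [Finset.mem_product, Finset.mem_range, Finset.mem_range]
  constructor
  · refine (YoungDiagram.mem_iff_lt_colLen.1 hc').trans_le ?_
    rw [YoungDiagram.colLen_eq_card]
    exact Finset.card_le_card (Finset.filter_subset _ _)
  · refine (YoungDiagram.mem_iff_lt_rowLen.1 hc').trans_le ?_
    rw [YoungDiagram.rowLen_eq_card]
    exact Finset.card_le_card (Finset.filter_subset _ _)

/-- `Y_N`, the finite set of all Young diagrams with `N` cells. -/
noncomputable def youngDiagrams (N : ℕ) : Finset YoungDiagram := (finite_setOf_card_eq N).toFinset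

/-- `q^{(k)}_{n,N}` for `k ≥ 1`: the probability, under Plancherel measure `μ ↦ d_μ² / N!`
on `Y_N`, that the `k`-th row has at most `n` cells. Mathlib numbers the rows from `0`. For `N = 0`
the only diagram is the empty one and the value is `1` (see `q_zero`). -/
noncomputable def q (k n N : ℕ) : ℝ :=
  ∑ μ ∈ youngDiagrams N with μ.rowLen (k - 1) ≤ n, (numSYT μ : ℝ) ^ 2 / (N ! : ℝ)

theorem q_zero (k n : ℕ) : q k n 0 = 1 := by
  have hY : youngDiagrams 0 = {⊥} := by
    ext μ
    simp only [youngDiagrams, Set.Finite.mem_toFinset, Set.mem_ofPred_eq, Finset.mem_singleton]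
    constructor
    · intro h
      exact YoungDiagram.ext (Finset.card_eq_zero.1 h)
    · rintro rfl
      rfl
  have hr : (⊥ : YoungDiagram).rowLen (k - 1) = 0 := by
    rw [YoungDiagram.rowLen_eq_card]; rfl
  have hd : numSYT ⊥ = 1 := by
    have hE : IsEmpty (⊥ : YoungDiagram).cells := ⟨fun c => absurd c.2 (Finset.notMem_empty _)⟩
    have hF : IsEmpty (Fin (⊥ : YoungDiagram).card) := ⟨fun c => absurd c.2 (Nat.not_lt_zero _)⟩
    rw [numSYT, Nat.card_eq_one_iff_unique]
    refine ⟨⟨fun a b => Subtype.ext (Equiv.ext fun c => hE.elim c)⟩, ⟨⟨Equiv.equivOfIsEmpty _ _, ?_⟩⟩⟩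
    exact ⟨fun c => hE.elim c, fun c => hE.elim c⟩
  simp [q, hY, hd, hr, Finset.filter_singleton]

/-- The `N`-th term of the Poissonization of `q^{(k)}_{n,N}`. -/
noncomputable def phiTerm (k n : ℕ) (lam : ℝ) (N : ℕ) : ℝ :=
  Real.exp (-lam) * lam ^ N / (N ! : ℝ) * q k n N

/-- `φ^{(k)}_n(λ) = ∑_N e^{-λ} λ^N / N! q^{(k)}_{n,N}`. -/
noncomputable def phi (k n : ℕ) (lam : ℝ) : ℝ := ∑' N : ℕ, phiTerm k n lam N

/-- The `n × n` Toeplitz matrix `T_{n-1}` of the weight `e^{2√λ cos θ} dθ / 2π`. -/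
noncomputable def toeplitz (lam : ℝ) (n : ℕ) : Matrix (Fin n) (Fin n) ℂ :=
  Matrix.of fun j k => ∫ θ in (0 : ℝ)..2 * Real.pi,
    Complex.exp (-Complex.I * ((j : ℂ) - (k : ℂ)) * θ) *
      (Real.exp (2 * √lam * Real.cos θ) : ℂ) / (2 * Real.pi)

/-- `a_0(s)`; in the series for `s ≥ 1` the summation index `m ≥ 1` is written `m = i + 1`. -/
noncomputable def aZero (lam : ℝ) (s : ℕ) : ℝ :=
  if s = 0 then ∑' m : ℕ, lam ^ m / (m ! : ℝ) ^ 2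
  else ∑' i : ℕ, lam ^ (i + 1) / (((i : ℝ) + 1 + s) ^ 2 * (i ! : ℝ) ^ 2)

/-- `a_j(s) = ∑_{m ≥ j} λ^{m - j/2} / ((m + s) (m - 1)! (m - j)!)` for `j ≥ 1`; the summation
index is written `m = i + j`. -/
noncomputable def a (lam : ℝ) (j s : ℕ) : ℝ :=
  ∑' i : ℕ, lam ^ ((i : ℝ) + (j : ℝ) / 2) /
    (((i : ℝ) + j + s) * ((i + j - 1)! : ℝ) * (i ! : ℝ))

/-- `b_n(s) = (a_1(s), …, a_n(s))ᵀ`. -/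
noncomputable def b (lam : ℝ) (n s : ℕ) : Fin n → ℂ := fun j => (a lam ((j : ℕ) + 1) s : ℂ)

/-- `λ^s / (s!)² (a_0(s) - (T_{n-1}⁻¹ b_n(s), b_n(s)))`. -/
noncomputable def bracketTerm (lam : ℝ) (n s : ℕ) : ℂ :=
  (lam : ℂ) ^ s / (s ! : ℂ) ^ 2 *
    ((aZero lam s : ℂ) - ((toeplitz lam n)⁻¹.mulVec (b lam n s)) ⬝ᵥ star (b lam n s))

end PlancherelSecondRow

/-! Put `x = √λ`. Up to the factor `e^{-λ}`, a diagram contributes `λ^|μ| (d_μ / |μ|!)²`, and the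
point is to write this as the square of a determinant. A diagram whose second row has at most `L`
cells is given by its first `L` columns and by the number `s` of first-row cells beyond them (the
arm). The column lengths become a strictly increasing tuple `h`, and `d_μ = N!/s! · det (f_j (h_i))`
with `f_j(m) = 1/(m-j)!`, except that `f_0(m) = 1/((m-1)! (m+s))` when `s > 0`. This is
`IsColumnShape.card_increasingFilling`: both sides satisfy the recursion that removes the cell with
the largest label.

Summing the squares over `h` is the Andréief identity `hasSum_strictMono_det_sq`, which gives the
determinant of the Gram matrix `G_s` of the sequences `x^(m-j) f_j(m)`. For `s = 0`, `L = n` these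
are the coefficients of `z^j e^{xz}`, so by Parseval `G_0 = T_{n-1}` and `φ^{(1)}_n = e^{-λ} det
T_{n-1}`. The empty diagram alone contributes `e^{-λ}`, hence `det T_{n-1} ≥ 1`.

For `L = n+1` one gets `φ^{(2)}_{n+1} = e^{-λ} ∑_s λ^s/(s!)² det G_s`. Only row and column `0` of
`G_s` depend on `s`: the rest is `T_{n-1}`, bordered by `a_0(s)` and `b_n(s)`. The Schur complement
then produces the bracket. -/

namespace PlancherelSecondRow

open scoped Nat

/-! ### Removing the largest label from a filling -/

/-- Bijective fillings of a finite set of cells that increase along rows and down columns. -/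
def IncreasingFilling (S : Finset (ℕ × ℕ)) (N : ℕ) : Type :=
  {T : S ≃ Fin N //
    (∀ c c' : S, c.1.1 = c'.1.1 → c.1.2 < c'.1.2 → T c < T c') ∧
    (∀ c c' : S, c.1.2 = c'.1.2 → c.1.1 < c'.1.1 → T c < T c')}

instance (S : Finset (ℕ × ℕ)) (N : ℕ) : Finite (IncreasingFilling S N) :=
  inferInstanceAs (Finite (Subtype _))

theorem numSYT_eq_card_increasingFilling (μ : YoungDiagram) :
    numSYT μ = Nat.card (IncreasingFilling μ.cells μ.card) := rfl

/-- A cell of `S` with no cell of `S` to its right or below it. -/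
def IsOuterCell (S : Finset (ℕ × ℕ)) (x : ℕ × ℕ) : Prop :=
  x ∈ S ∧ ∀ y ∈ S, ¬ (x.1 = y.1 ∧ x.2 < y.2) ∧ ¬ (x.2 = y.2 ∧ x.1 < y.1)

/-- Removing the largest label. -/
def restrictEquiv {S : Finset (ℕ × ℕ)} {N : ℕ} (T : S ≃ Fin (N + 1)) (x : S)
    (hx : T x = Fin.last N) : (S.erase x.1 : Finset (ℕ × ℕ)) ≃ Fin N where
  toFun y := (T ⟨y.1, Finset.mem_of_mem_erase y.2⟩).castPred (by
    rw [← hx]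
    intro h
    have := T.injective h
    exact Finset.ne_of_mem_erase y.2 (congrArg Subtype.val this))
  invFun k := ⟨(T.symm k.castSucc).1, by
    refine Finset.mem_erase.2 ⟨fun h => ?_, (T.symm k.castSucc).2⟩
    have h1 : T.symm k.castSucc = x := Subtype.ext h
    rw [Equiv.symm_apply_eq, hx] at h1
    exact absurd h1 (Fin.castSucc_lt_last k).ne⟩
  left_inv y := by simp
  right_inv k := by simp

/-- Adding a cell with the largest label. -/
def extendEquiv {S : Finset (ℕ × ℕ)} {N : ℕ} (x : S)
    (T : (S.erase x.1 : Finset (ℕ × ℕ)) ≃ Fin N) : S ≃ Fin (N + 1) where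
  toFun y := if h : y.1 = x.1 then Fin.last N else
    (T ⟨y.1, Finset.mem_erase.2 ⟨h, y.2⟩⟩).castSucc
  invFun k := if h : k = Fin.last N then x else
    ⟨(T.symm (k.castPred h)).1, Finset.mem_of_mem_erase (T.symm (k.castPred h)).2⟩
  left_inv y := by
    by_cases h : y.1 = x.1
    · simp [h, Subtype.ext_iff]
    · simp [h, Fin.castSucc_ne_last]
  right_inv k := by
    by_cases h : k = Fin.last N
    · simp [h]
    · have := Finset.ne_of_mem_erase (T.symm (k.castPred h)).2
      simp [h, this]

/-- An increasing filling is determined by the cell of the largest label and the rest. -/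
def increasingFillingSuccEquiv (S : Finset (ℕ × ℕ)) (N : ℕ) :
    IncreasingFilling S (N + 1) ≃
      Σ x : {x // IsOuterCell S x}, IncreasingFilling (S.erase x.1) N where
  toFun T := ⟨⟨(T.1.symm (Fin.last N)).1, (T.1.symm (Fin.last N)).2, fun y hy => by
      constructor
      · rintro ⟨h1, h2⟩
        have := T.2.1 (T.1.symm (Fin.last N)) ⟨y, hy⟩ h1 h2
        simp at this
        exact absurd this (Fin.le_last _).not_gt
      · rintro ⟨h1, h2⟩
        have := T.2.2 (T.1.symm (Fin.last N)) ⟨y, hy⟩ h1 h2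
        simp at this
        exact absurd this (Fin.le_last _).not_gt⟩,
    ⟨restrictEquiv T.1 (T.1.symm (Fin.last N)) (by simp),
      fun c c' h1 h2 => by
        have := T.2.1 ⟨c.1, Finset.mem_of_mem_erase c.2⟩ ⟨c'.1, Finset.mem_of_mem_erase c'.2⟩ h1 h2
        simpa [restrictEquiv] using this,
      fun c c' h1 h2 => by
        have := T.2.2 ⟨c.1, Finset.mem_of_mem_erase c.2⟩ ⟨c'.1, Finset.mem_of_mem_erase c'.2⟩ h1 h2
        simpa [restrictEquiv] using this⟩⟩
  invFun p := ⟨extendEquiv ⟨p.1.1, p.1.2.1⟩ p.2.1, by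
    obtain ⟨⟨x, hxS, hx⟩, T, hT1, hT2⟩ := p
    constructor
    · intro c c' h1 h2
      have hc : c.1 ≠ x := fun h => (hx c'.1 c'.2).1 ⟨h ▸ h1, h ▸ h2⟩
      by_cases hc' : c'.1 = x
      · simp [extendEquiv, hc, hc', Fin.castSucc_lt_last]
      · simpa [extendEquiv, hc, hc'] using
          hT1 ⟨c.1, Finset.mem_erase.2 ⟨hc, c.2⟩⟩ ⟨c'.1, Finset.mem_erase.2 ⟨hc', c'.2⟩⟩ h1 h2
    · intro c c' h1 h2
      have hc : c.1 ≠ x := fun h => (hx c'.1 c'.2).2 ⟨h ▸ h1, h ▸ h2⟩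
      by_cases hc' : c'.1 = x
      · simp [extendEquiv, hc, hc', Fin.castSucc_lt_last]
      · simpa [extendEquiv, hc, hc'] using
          hT2 ⟨c.1, Finset.mem_erase.2 ⟨hc, c.2⟩⟩ ⟨c'.1, Finset.mem_erase.2 ⟨hc', c'.2⟩⟩ h1 h2⟩
  left_inv T := by
    apply Subtype.ext
    ext y
    by_cases h : y = T.1.symm (Fin.last N)
    · subst h
      simp [extendEquiv]
    · simp [extendEquiv, restrictEquiv, h]
  right_inv p := by
    obtain ⟨⟨x, hxS, hx⟩, T, hT⟩ := p
    have hlast : (extendEquiv ⟨x, hxS⟩ T).symm (Fin.last N) = ⟨x, hxS⟩ := by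
      simp [extendEquiv]
    refine Sigma.ext (Subtype.ext (by simp [hlast])) ?_
    -- The type of the smaller filling depends on the removed cell, so that cell is generalised
    -- before the two are identified.
    have key : ∀ (z : S) (hz : z = ⟨x, hxS⟩) (U : IncreasingFilling (S.erase z.1) N),
        (∀ y (hy : y ∈ S.erase x) (hy' : y ∈ S.erase z.1), U.1 ⟨y, hy'⟩ = T ⟨y, hy⟩) →
        HEq U (⟨T, hT⟩ : IncreasingFilling (S.erase x) N) := by
      rintro _ rfl U hU
      refine heq_of_eq (Subtype.ext (Equiv.ext fun y => hU y.1 y.2 y.2))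
    refine key _ hlast _ ?_
    intro y hy hy'
    have : y ≠ x := Finset.ne_of_mem_erase hy
    refine Fin.ext ?_
    change ((extendEquiv ⟨x, hxS⟩ T ⟨y, Finset.mem_of_mem_erase hy⟩ : Fin (N + 1)) : ℕ) = _
    simp [extendEquiv, this]

theorem card_increasingFilling_succ (S : Finset (ℕ × ℕ)) (N : ℕ) (C : Finset (ℕ × ℕ))
    (hC : ∀ x, x ∈ C ↔ IsOuterCell S x) :
    Nat.card (IncreasingFilling S (N + 1)) =
      ∑ x ∈ C, Nat.card (IncreasingFilling (S.erase x) N) := by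
  have : Fintype {x // IsOuterCell S x} := Fintype.subtype C hC
  rw [Nat.card_congr (increasingFillingSuccEquiv S N), Nat.card_sigma,
    Finset.sum_subtype C hC (fun x => Nat.card (IncreasingFilling (S.erase x) N))]

theorem card_increasingFilling_empty : Nat.card (IncreasingFilling ∅ 0) = 1 := by
  rw [Nat.card_eq_one_iff_unique]
  refine ⟨⟨fun a b => Subtype.ext (Equiv.ext fun c => absurd c.2 (Finset.notMem_empty _))⟩,
    ⟨⟨Equiv.equivOfIsEmpty _ _, ?_⟩⟩⟩
  exact ⟨fun c => absurd c.2 (Finset.notMem_empty _), fun c => absurd c.2 (Finset.notMem_empty _)⟩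

/-! ### The determinant entries and their recursion -/

/-- The functions whose determinants count standard tableaux: `x ^ (m - j) / (m - j)!` (zero for
`m < j`), except that for `s ≠ 0` the function with `j = 0` is `x ^ m / ((m - 1)! (m + s))`. -/
noncomputable def entry (x : ℝ) (s j m : ℕ) : ℝ :=
  if j = 0 ∧ s ≠ 0 then x ^ m * m / (m ! * (m + s)) else x ^ (m - j) * m.descFactorial j / m !

/-- The value of `entry 1 s j` at `m - 1`, read as `0` for `m = 0`. -/
noncomputable def prevEntry (s j m : ℕ) : ℝ := if m = 0 then 0 else entry 1 s j (m - 1)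

theorem prevEntry_eq {s j m : ℕ} (h : ¬ (j = 0 ∧ s ≠ 0)) :
    prevEntry s j m = (m - j) * entry 1 s j m := by
  unfold prevEntry entry
  rcases m with _ | k
  · rcases j with _ | j <;> simp
  · simp only [h, if_false, Nat.add_one_ne_zero, Nat.add_sub_cancel, one_pow, one_mul]
    have h1 := Nat.succ_descFactorial k j
    have h2 : ((k + 1 : ℕ) - j : ℝ) * ((k + 1).descFactorial j : ℝ) =
        (k + 1 : ℝ) * (k.descFactorial j : ℝ) := by
      by_cases hj : j ≤ k + 1
      · have := congrArg (Nat.cast : ℕ → ℝ) h1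
        rw [Nat.cast_mul, Nat.cast_mul, Nat.cast_sub hj] at this
        push_cast at this ⊢
        linarith
      · rw [Nat.descFactorial_of_lt (by omega), Nat.descFactorial_of_lt (by omega)]
        simp
    rw [Nat.factorial_succ, mul_div_assoc', h2]
    have : (k ! : ℝ) ≠ 0 := by positivity
    push_cast
    field_simp

/-- This relation dictates the form of column `0`: its last term lowers `s` by one and will account
for the removal of an arm cell. -/
theorem prevEntry_zero_eq {s m : ℕ} (hm : s ≠ 0 → m ≠ 0) :
    prevEntry s 0 m = (m + s) * entry 1 s 0 m - s * entry 1 (s - 1) 0 m := by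
  rcases s with _ | s
  · rw [prevEntry_eq (by simp)]; simp
  · obtain ⟨k, rfl⟩ := Nat.exists_eq_succ_of_ne_zero (hm (by simp))
    have hk : (k ! : ℝ) ≠ 0 := by positivity
    have h1 : (k + (s + 1) : ℝ) ≠ 0 := by positivity
    have h2 : (k + 1 + (s + 1) : ℝ) ≠ 0 := by positivity
    have h3 : (k + 1 : ℝ) ≠ 0 := by positivity
    have h4 : entry 1 s 0 (k + 1) = 1 / (k ! * (k + (s + 1))) := by
      unfold entry
      rcases s with _ | s
      · simp [Nat.factorial_succ]; ring
      · simp [Nat.factorial_succ]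
        have : (k + 1 + (s + 1) : ℝ) ≠ 0 := by positivity
        have : (k + (s + 1 + 1) : ℝ) ≠ 0 := by positivity
        field_simp
        ring
    simp only [Nat.succ_eq_add_one, Nat.add_sub_cancel, h4]
    simp [prevEntry, entry, Nat.factorial_succ]
    field_simp
    ring

/-- The matrix `(entry x s j (h i))`. -/
noncomputable def entryMatrix (x : ℝ) (s : ℕ) {L : ℕ} (h : Fin L → ℕ) : Matrix (Fin L) (Fin L) ℝ :=
  Matrix.of fun i j => entry x s j (h i)

/-- In the Leibniz expansion the term of `σ` acquires the factor `c (σ i)`, and summing over `i`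
gives `∑ j, c j` for every `σ`. -/
theorem sum_det_updateRow_mul {n : Type*} [Fintype n] [DecidableEq n] (D : Matrix n n ℝ)
    (E : n → n → ℝ) (c : n → ℝ) (hE : ∀ i j, E i j = D i j * c j) :
    ∑ i, (D.updateRow i (E i)).det = (∑ j, c j) * D.det := by
  have h : ∀ i, (D.updateRow i (E i)).det =
      ∑ σ : Equiv.Perm n, (Equiv.Perm.sign σ : ℝ) * ((∏ k, D k (σ k)) * c (σ i)) := by
    intro i
    rw [← Matrix.det_transpose, Matrix.det_apply']
    refine Finset.sum_congr rfl fun σ _ => ?_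
    congr 1
    rw [← Finset.mul_prod_erase Finset.univ _ (Finset.mem_univ i),
      ← Finset.mul_prod_erase Finset.univ (fun k => D k (σ k)) (Finset.mem_univ i)]
    rw [Finset.prod_congr rfl (g := fun k => D k (σ k))]
    · simp [hE]; ring
    · intro k hk
      simp [Matrix.updateRow_ne (Finset.ne_of_mem_erase hk)]
  simp_rw [h]
  rw [Finset.sum_comm, ← Matrix.det_transpose D, Matrix.det_apply', Finset.mul_sum]
  refine Finset.sum_congr rfl fun σ _ => ?_
  rw [← Finset.mul_sum, ← Finset.mul_sum, Equiv.sum_comp σ c]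
  simp only [Matrix.transpose_apply]
  ring

/-- Both sides are the cofactor expansion along column `j`. -/
theorem sum_det_updateRow_single {n : Type*} [Fintype n] [DecidableEq n] (D : Matrix n n ℝ)
    (j : n) (v : n → ℝ) :
    ∑ i, (D.updateRow i (Pi.single j (v i))).det = (D.updateCol j v).det := by
  have h : ∀ i, (D.updateRow i (Pi.single j (v i))).det = v i * D.adjugate j i := by
    intro i
    rw [Matrix.adjugate_apply, ← Matrix.det_updateRow_smul]
    congr 2
    ext k
    simp [Pi.single_apply]
  simp_rw [h]
  rw [← Matrix.cramer_apply, Matrix.cramer_eq_adjugate_mulVec, Matrix.mulVec, dotProduct]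
  exact Finset.sum_congr rfl fun i _ => mul_comm _ _

/-- The entry recursions, summed over rows: this is the determinant side of the recursion for
tableaux. -/
theorem sum_det_prevEntry {L s : ℕ} (h : Fin L → ℕ) (hpos : s ≠ 0 → ∀ i, h i ≠ 0)
    (hL : s ≠ 0 → L ≠ 0) :
    ∑ i, ((entryMatrix 1 s h).updateRow i fun j => prevEntry s j (h i)).det =
      (∑ i, (h i : ℝ) - ∑ j : Fin L, (j : ℝ) + s) * (entryMatrix 1 s h).det
        - s * (entryMatrix 1 (s - 1) h).det := by
  set D := entryMatrix 1 s h with hD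
  rcases Nat.eq_zero_or_pos s with rfl | hs
  · have hrow : ∀ i, (D.updateRow i fun j => prevEntry 0 j (h i)).det =
        (h i : ℝ) * D.det - (D.updateRow i fun j => D i j * (j : ℝ)).det := by
      intro i
      have : (fun j : Fin L => prevEntry 0 j (h i)) =
          (h i : ℝ) • D i + (-1 : ℝ) • fun j : Fin L => D i j * (j : ℝ) := by
        ext j
        rw [prevEntry_eq (by simp)]
        simp [hD, entryMatrix]; ring
      rw [this, Matrix.det_updateRow_add, Matrix.det_updateRow_smul, Matrix.det_updateRow_smul,
        Matrix.updateRow_eq_self]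
      ring
    simp_rw [hrow]
    rw [Finset.sum_sub_distrib, ← Finset.sum_mul, sum_det_updateRow_mul D (fun i j => D i j * (j : ℝ)) _
      (fun _ _ => rfl)]
    simp
    ring
  · obtain ⟨n, rfl⟩ := Nat.exists_eq_succ_of_ne_zero (hL hs.ne')
    -- Column `0` has the factor `h i + s` where column `j` has `h i - j`; both equal `h i - c j`.
    let c : Fin (n + 1) → ℝ := fun j => j - if j = 0 then (s : ℝ) else 0
    have hrow : ∀ i, (D.updateRow i fun j => prevEntry s j (h i)).det =
        (h i : ℝ) * D.det - (D.updateRow i fun j => D i j * c j).det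
          - s * (D.updateRow i (Pi.single 0 (entry 1 (s - 1) 0 (h i)))).det := by
      intro i
      have : (fun j : Fin (n + 1) => prevEntry s j (h i)) =
          (h i : ℝ) • D i + (-1 : ℝ) • (fun j => D i j * c j)
            + (-s : ℝ) • Pi.single 0 (entry 1 (s - 1) 0 (h i)) := by
        ext j
        by_cases hj : j = 0
        · subst hj
          simp only [Fin.val_zero]
          rw [prevEntry_zero_eq (fun h' => hpos h' i)]
          simp [hD, entryMatrix, c]; ring
        · have hj' : (j : ℕ) ≠ 0 := fun h' => hj (Fin.ext h')
          rw [prevEntry_eq (by simp [hj'])]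
          simp [hD, entryMatrix, c, hj]; ring
      rw [this, Matrix.det_updateRow_add, Matrix.det_updateRow_add, Matrix.det_updateRow_smul,
        Matrix.det_updateRow_smul, Matrix.det_updateRow_smul, Matrix.updateRow_eq_self]
      ring
    simp_rw [hrow]
    rw [Finset.sum_sub_distrib, Finset.sum_sub_distrib, ← Finset.sum_mul,
      sum_det_updateRow_mul D (fun i j => D i j * c j) _ (fun _ _ => rfl), ← Finset.mul_sum,
      sum_det_updateRow_single]
    have hcol : D.updateCol 0 (fun i => entry 1 (s - 1) 0 (h i)) = entryMatrix 1 (s - 1) h := by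
      ext i j
      by_cases hj : j = 0
      · subst hj; simp [entryMatrix]
      · have hj' : (j : ℕ) ≠ 0 := fun h' => hj (Fin.ext h')
        simp only [Matrix.updateCol_ne hj, hD, entryMatrix, entry, Matrix.of_apply, hj', false_and,
          if_false]
    have hc : ∑ j, c j = ∑ j : Fin (n + 1), (j : ℝ) - s := by
      simp only [c, Finset.sum_sub_distrib, Finset.sum_ite_eq', Finset.mem_univ, if_true]
    rw [hcol, hc]
    ring

/-! ### Column shapes and the determinantal count of tableaux -/

/-- The strictly increasing sequence `c (L - 1), c (L - 2) + 1, …, c 0 + L - 1`. -/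
def profile (L : ℕ) (c : ℕ → ℕ) (i : Fin L) : ℕ := c (Fin.rev i) + i

theorem profile_update_rev {L : ℕ} (c : ℕ → ℕ) (i : Fin L) (hc : c (Fin.rev i) ≠ 0) :
    profile L (Function.update c (Fin.rev i) (c (Fin.rev i) - 1)) =
      Function.update (profile L c) i (profile L c i - 1) := by
  ext k
  by_cases hk : k = i
  · subst hk
    simp only [profile, Function.update_self]
    omega
  · have : (Fin.rev k : ℕ) ≠ Fin.rev i := fun h => hk (Fin.rev_injective (Fin.ext h))
    simp only [profile, Function.update_of_ne hk, Function.update_of_ne this]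

theorem profile_update_of_le {L p : ℕ} (c : ℕ → ℕ) (hp : L ≤ p) (v : ℕ) :
    profile L (Function.update c p v) = profile L c := by
  ext k
  have : (Fin.rev k : ℕ) ≠ p := by have := (Fin.rev k).2; omega
  simp only [profile, Function.update_of_ne this]

theorem entryMatrix_update {L s : ℕ} (h : Fin L → ℕ) (i : Fin L) (hi : h i ≠ 0) :
    entryMatrix 1 s (Function.update h i (h i - 1)) =
      (entryMatrix 1 s h).updateRow i fun j => prevEntry s j (h i) := by
  ext k j
  by_cases hk : k = i
  · subst hk; simp [entryMatrix, prevEntry, hi]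
  · simp [entryMatrix, Function.update_of_ne hk, Matrix.updateRow_ne hk]

/-- `S` consists of the first `c p` cells of column `p`, where column `p ≥ L` has one cell for
`p < L + s` and none for larger `p`. -/
structure IsColumnShape (L s : ℕ) (c : ℕ → ℕ) (S : Finset (ℕ × ℕ)) : Prop where
  anti : Antitone c
  mem : ∀ a p, (a, p) ∈ S ↔ a < c p
  tail : ∀ p, L ≤ p → c p = if p < L + s then 1 else 0

namespace IsColumnShape

variable {L s : ℕ} {c : ℕ → ℕ} {S : Finset (ℕ × ℕ)}

theorem card_eq_sum (H : IsColumnShape L s c S) : S.card = ∑ p ∈ Finset.range (L + s), c p := by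
  rw [Finset.card_eq_sum_card_fiberwise (f := Prod.snd) (t := Finset.range (L + s))]
  · refine Finset.sum_congr rfl fun p _ => ?_
    have : S.filter (fun x => x.2 = p) = (Finset.range (c p)).image fun a => (a, p) := by
      ext ⟨a, p'⟩
      simp only [Finset.mem_filter, H.mem, Finset.mem_image, Finset.mem_range, Prod.mk.injEq]
      constructor
      · rintro ⟨h, rfl⟩; exact ⟨a, h, rfl, rfl⟩
      · rintro ⟨_, h, rfl, rfl⟩; exact ⟨h, rfl⟩
    rw [this, Finset.card_image_of_injective _ (fun a b h => (Prod.mk.inj h).1), Finset.card_range]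
  · rintro ⟨a, p⟩ hx
    have h1 := (H.mem a p).1 hx
    simp only [Finset.coe_range, Set.mem_Iio]
    by_contra h2
    rw [H.tail p (by omega), if_neg h2] at h1
    omega

theorem card_add_sum (H : IsColumnShape L s c S) :
    S.card + ∑ i : Fin L, (i : ℕ) = ∑ i, profile L c i + s := by
  rw [H.card_eq_sum, Finset.sum_range_add]
  have h1 : ∑ k ∈ Finset.range s, c (L + k) = s := by
    rw [Finset.sum_congr rfl (g := fun _ => 1)]
    · simp
    · intro k hk
      rw [H.tail _ (by omega), if_pos (by have := Finset.mem_range.1 hk; omega)]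
  have h2 : ∑ p ∈ Finset.range L, c p = ∑ i : Fin L, c (Fin.rev i) := by
    rw [Finset.sum_range]
    exact (Equiv.sum_comp Fin.revPerm (fun i : Fin L => c i)).symm
  rw [h1, h2]
  simp only [profile, Finset.sum_add_distrib]
  omega

theorem profile_ne_zero (H : IsColumnShape L s c S) (hs : s ≠ 0) (i : Fin L) :
    profile L c i ≠ 0 := by
  have h1 := H.anti (Fin.rev i).2.le
  rw [H.tail L le_rfl, if_pos (by omega)] at h1
  unfold profile
  omega

theorem strictMono_profile (H : IsColumnShape L s c S) : StrictMono (profile L c) := by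
  intro i j hij
  have h1 : c (Fin.rev i) ≤ c (Fin.rev j) := H.anti (Fin.rev_le_rev.2 hij.le)
  have h2 : (i : ℕ) < j := hij
  unfold profile
  omega

theorem isOuterCell_iff (H : IsColumnShape L s c S) (x : ℕ × ℕ) :
    x ∈ ((Finset.range (L + s)).filter fun p => c (p + 1) < c p).image (fun p => (c p - 1, p)) ↔
      IsOuterCell S x := by
  obtain ⟨a, p⟩ := x
  simp only [Finset.mem_image, Finset.mem_filter, Finset.mem_range, Prod.mk.injEq, IsOuterCell,
    H.mem]
  constructor
  · rintro ⟨p', ⟨h1, h2⟩, h3, rfl⟩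
    refine ⟨by omega, ?_⟩
    rintro ⟨a', q⟩ hy
    simp only at hy ⊢
    constructor
    · rintro ⟨h4, h5⟩
      have := H.anti (show p' + 1 ≤ q from h5)
      omega
    · rintro ⟨h4, h5⟩
      subst h4
      omega
  · rintro ⟨h1, h2⟩
    have h3 := (h2 (a, p + 1))
    have h4 := (h2 (a + 1, p))
    simp only [true_and, lt_add_iff_pos_right, zero_lt_one, not_true_eq_false,
      and_false, imp_false, not_lt, false_and] at h3 h4
    refine ⟨p, ⟨?_, by omega⟩, by omega, rfl⟩
    by_contra h5
    rw [H.tail p (by omega), if_neg h5] at h1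
    omega

theorem mem_erase (H : IsColumnShape L s c S) {p : ℕ} (hp : c (p + 1) < c p) (a q : ℕ) :
    (a, q) ∈ S.erase (c p - 1, p) ↔ a < Function.update c p (c p - 1) q := by
  rw [Finset.mem_erase, H.mem]
  by_cases hq : q = p
  · subst hq
    simp only [ne_eq, Prod.mk.injEq, and_true, Function.update_self]
    omega
  · simp [hq]

theorem antitone_update (H : IsColumnShape L s c S) {p : ℕ} (hp : c (p + 1) < c p) :
    Antitone (Function.update c p (c p - 1)) := by
  refine antitone_nat_of_succ_le fun q => ?_
  have : c (q + 1) ≤ c q := H.anti (Nat.le_succ q)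
  rcases eq_or_ne q p with rfl | h1
  · rw [Function.update_of_ne (by omega), Function.update_self]
    omega
  · rw [Function.update_of_ne h1]
    rcases eq_or_ne (q + 1) p with rfl | h2
    · rw [Function.update_self]
      omega
    · rwa [Function.update_of_ne h2]

theorem erase_of_lt (H : IsColumnShape L s c S) {p : ℕ} (hp : c (p + 1) < c p) (hpL : p < L) :
    IsColumnShape L s (Function.update c p (c p - 1)) (S.erase (c p - 1, p)) where
  anti := H.antitone_update hp
  mem := H.mem_erase hp
  tail q hq := by rw [Function.update_of_ne (by omega), H.tail q hq]

theorem erase_last (H : IsColumnShape L (s + 1) c S) (hp : c (L + s + 1) < c (L + s)) :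
    IsColumnShape L s (Function.update c (L + s) (c (L + s) - 1))
      (S.erase (c (L + s) - 1, L + s)) where
  anti := H.antitone_update hp
  mem := H.mem_erase hp
  tail q hq := by
    rcases eq_or_ne q (L + s) with rfl | h
    · rw [Function.update_self, H.tail _ hq, if_pos (by omega), if_neg (by omega)]
    · rw [Function.update_of_ne h, H.tail q hq]
      congr 1
      simp only [eq_iff_iff]
      omega

/-- Lowering a column with no removable cell either makes two rows coincide or, for column `L - 1`,
gives a zero row. So the recursion may run over all columns. -/
theorem det_updateRow_prevEntry_eq_zero (H : IsColumnShape L s c S) (i : Fin L)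
    (hi : ¬ c (Fin.rev i + 1) < c (Fin.rev i)) :
    ((entryMatrix 1 s (profile L c)).updateRow i fun j => prevEntry s j (profile L c i)).det = 0 := by
  have heq : c (Fin.rev i + 1) = c (Fin.rev i) :=
    le_antisymm (H.anti (Nat.le_succ _)) (not_lt.1 hi)
  rcases Nat.eq_zero_or_pos (i : ℕ) with h0 | h0
  · refine Matrix.det_eq_zero_of_row_eq_zero i fun j => ?_
    rw [Matrix.updateRow_self]
    have hrev : (Fin.rev i : ℕ) + 1 = L := by rw [Fin.val_rev]; have := i.2; omega
    rw [hrev, H.tail L le_rfl] at heq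
    have hpr : profile L c i = c (Fin.rev i) := by simp [profile, h0]
    by_cases hs : s = 0
    · rw [if_neg (by omega)] at heq
      rw [hpr, ← heq]
      simp [prevEntry]
    · rw [if_pos (by omega)] at heq
      rw [hpr, ← heq]
      rcases hj : (j : ℕ) with _ | j' <;> simp [prevEntry, entry, hs]
  · let k : Fin L := ⟨i - 1, by have := i.2; omega⟩
    have hk : k ≠ i := by
      intro h
      have := congrArg Fin.val h
      simp only [k] at this
      omega
    have hrev : (Fin.rev k : ℕ) = Fin.rev i + 1 := by
      simp only [Fin.val_rev, k]; have := i.2; omega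
    have hpr : profile L c i = profile L c k + 1 := by
      simp only [profile, hrev, heq, k]
      omega
    refine Matrix.det_zero_of_row_eq hk ?_
    rw [Matrix.updateRow_ne hk, Matrix.updateRow_self]
    ext j
    simp [entryMatrix, prevEntry, hpr]

theorem card_increasingFilling (N : ℕ) : ∀ {s : ℕ} {c : ℕ → ℕ} {S : Finset (ℕ × ℕ)},
    IsColumnShape L s c S → (s ≠ 0 → L ≠ 0) → S.card = N →
    (Nat.card (IncreasingFilling S N) : ℝ) =
      (N ! : ℝ) / s ! * (entryMatrix 1 s (profile L c)).det := by
  induction N with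
  | zero =>
    intro s c S H hL hS
    have hS' := Finset.card_eq_zero.1 hS
    subst hS'
    have hc : ∀ p, c p = 0 := by
      intro p
      by_contra h
      exact absurd ((H.mem 0 p).2 (by omega)) (Finset.notMem_empty _)
    have hs : s = 0 := by
      by_contra h
      have := H.tail L le_rfl
      rw [hc, if_pos (by omega)] at this
      omega
    subst hs
    -- Here `h i = i`, so the matrix is lower triangular with unit diagonal.
    rw [card_increasingFilling_empty, Matrix.det_of_isLowerTriangular]
    · simp [entryMatrix, profile, hc, entry, Nat.descFactorial_self, Nat.factorial_ne_zero]
    · intro i j hij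
      have hij' : (i : ℕ) < j := hij
      simp [entryMatrix, profile, hc, entry, Nat.descFactorial_of_lt hij']
  | succ N ih =>
    intro s c S H hL hS
    set h := profile L c with hh
    rw [card_increasingFilling_succ S N _ H.isOuterCell_iff,
      Finset.sum_image (fun p _ q _ hpq => (Prod.mk.inj hpq).2), Finset.sum_filter,
      Finset.sum_range_add, Finset.sum_range]
    have hcard : ∀ p, c (p + 1) < c p → (S.erase (c p - 1, p)).card = N := by
      intro p hp
      rw [Finset.card_erase_of_mem ((H.mem _ _).2 (by omega)), hS, Nat.add_sub_cancel]
    have h1 : ∀ i : Fin L, ((if c ((Fin.rev i : ℕ) + 1) < c (Fin.rev i) then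
        Nat.card (IncreasingFilling (S.erase (c (Fin.rev i) - 1, (Fin.rev i : ℕ))) N) else 0 : ℕ) : ℝ) =
        (N ! : ℝ) / s ! *
          ((entryMatrix 1 s h).updateRow i fun j => prevEntry s j (h i)).det := by
      intro i
      split_ifs with hi
      · rw [ih (H.erase_of_lt hi (Fin.rev i).2) hL (hcard _ hi), profile_update_rev _ _ (by omega),
          entryMatrix_update]
        simp only [profile]
        omega
      · rw [H.det_updateRow_prevEntry_eq_zero i hi]
        simp
    -- Only the last arm cell is outer; its removal lowers `s`, and `1/(s-1)! = s/s!`.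
    have h2 : ((∑ k ∈ Finset.range s, if c (L + k + 1) < c (L + k) then
        Nat.card (IncreasingFilling (S.erase (c (L + k) - 1, L + k)) N) else 0 : ℕ) : ℝ) =
        (N ! : ℝ) / s ! * (s * (entryMatrix 1 (s - 1) h).det) := by
      rcases s with _ | s
      · simp
      · have hlt : c (L + s + 1) < c (L + s) := by
          rw [H.tail _ (by omega), H.tail _ (by omega), if_neg (by omega), if_pos (by omega)]
          omega
        rw [Finset.sum_range_succ, Finset.sum_eq_zero, zero_add, if_pos hlt,
          ih (H.erase_last hlt) (fun _ => hL (by simp)) (hcard _ hlt), profile_update_of_le _ (by omega)]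
        · have : (s ! : ℝ) ≠ 0 := by positivity
          rw [Nat.factorial_succ, Nat.add_sub_cancel]
          push_cast
          field_simp
          rw [hh]
        · intro k hk
          have := Finset.mem_range.1 hk
          rw [if_neg]
          rw [H.tail _ (by omega), H.tail _ (by omega), if_pos (by omega), if_pos (by omega)]
          omega
    -- The coefficient in the determinant recursion is the number of cells, which turns `N!` into
    -- `(N + 1)!`.
    have h3 : (∑ i, (h i : ℝ) - ∑ j : Fin L, (j : ℝ) + s) = (N + 1 : ℝ) := by
      have := congrArg (Nat.cast : ℕ → ℝ) H.card_add_sum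
      rw [hS] at this
      push_cast at this
      linarith
    have h4 := sum_det_prevEntry h H.profile_ne_zero hL
    rw [h3] at h4
    rw [Nat.cast_add, h2, ← Equiv.sum_comp Fin.revPerm, Nat.cast_sum]
    simp only [Fin.revPerm_apply]
    rw [Finset.sum_congr rfl fun i _ => h1 i, ← Finset.mul_sum, h4, Nat.factorial_succ]
    push_cast
    ring

end IsColumnShape

/-! ### Cauchy–Binet and Andréief identities -/

theorem exists_unique_strictMono_comp {L : ℕ} {h : Fin L → ℕ} (hh : Function.Injective h) :
    ∃! σ : Equiv.Perm (Fin L), StrictMono (h ∘ σ) := by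
  refine ⟨Tuple.sort h, (Tuple.monotone_sort h).strictMono_of_injective
    (hh.comp (Tuple.sort h).injective), fun τ hτ => ?_⟩
  have := Tuple.unique_monotone hτ.monotone (Tuple.monotone_sort h)
  exact Equiv.ext fun i => hh (congrFun this i)

/-- The Cauchy–Binet formula for a Gram determinant, summed over increasing index tuples. -/
theorem det_sum_mul_eq_sum_strictMono {L : ℕ} (f : Fin L → ℕ → ℝ) (R : Finset ℕ) :
    (Matrix.of fun j k => ∑ m ∈ R, f j m * f k m).det =
      ∑ h ∈ Fintype.piFinset (fun _ : Fin L => R),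
        if StrictMono h then (Matrix.of fun i j => f j (h i)).det ^ 2 else 0 := by
  let D : (Fin L → ℕ) → ℝ := fun h => (Matrix.of fun i j => f j (h i)).det
  let G : (Fin L → ℕ) → ℝ := fun h => (∏ i, f i (h i)) * D h
  have hD : ∀ h, D h = ∑ σ : Equiv.Perm (Fin L), (Equiv.Perm.sign σ : ℝ) * ∏ i, f (σ i) (h i) := by
    intro h
    simp only [D]
    rw [← Matrix.det_transpose, Matrix.det_apply']
    rfl
  have hG0 : ∀ h, ¬ Function.Injective h → G h = 0 := by
    intro h hh
    rw [Function.not_injective_iff] at hh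
    obtain ⟨i, j, hij, hne⟩ := hh
    have : D h = 0 := Matrix.det_zero_of_row_eq hne (by ext k; simp [hij])
    simp [G, this]
  have hexp : (Matrix.of fun j k => ∑ m ∈ R, f j m * f k m).det =
      ∑ h ∈ Fintype.piFinset (fun _ : Fin L => R), G h := by
    rw [Matrix.det_apply']
    simp only [Matrix.of_apply, G, hD, Finset.mul_sum]
    rw [Finset.sum_comm]
    refine Finset.sum_congr rfl fun σ _ => ?_
    rw [Finset.prod_univ_sum, Finset.mul_sum]
    refine Finset.sum_congr rfl fun h _ => ?_
    rw [Finset.prod_mul_distrib]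
    ring
  -- An injective tuple is sorted by exactly one permutation; the other tuples contribute zero.
  have hsplit : ∀ h, G h = ∑ σ : Equiv.Perm (Fin L), if StrictMono (h ∘ σ) then G h else 0 := by
    intro h
    by_cases hh : Function.Injective h
    · obtain ⟨σ, hσ, huniq⟩ := exists_unique_strictMono_comp hh
      rw [Finset.sum_eq_single σ, if_pos hσ]
      · intro τ _ hτ
        exact if_neg fun h' => hτ (huniq τ h')
      · simp
    · simp [hG0 h hh]
  rw [hexp, Finset.sum_congr rfl fun h _ => hsplit h, Finset.sum_comm]
  -- Reindexing by `h ↦ h ∘ σ` puts the sign into `D`; the sum over `σ` then rebuilds a second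
  -- factor `D h`.
  have hre : ∀ σ : Equiv.Perm (Fin L),
      ∑ h ∈ Fintype.piFinset (fun _ : Fin L => R), (if StrictMono (h ∘ σ) then G h else 0) =
      ∑ h ∈ Fintype.piFinset (fun _ : Fin L => R),
        if StrictMono h then (Equiv.Perm.sign σ : ℝ) * (∏ i, f (σ i) (h i)) * D h else 0 := by
    intro σ
    refine Finset.sum_equiv (Equiv.arrowCongr σ.symm (Equiv.refl ℕ)) ?_ ?_
    · intro h
      simp only [Fintype.mem_piFinset, Equiv.arrowCongr_apply, Equiv.coe_refl, Function.comp_apply,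
        id_eq, Equiv.symm_symm]
      exact (σ.forall_congr_right (q := fun i => h i ∈ R)).symm
    · intro h _
      have h1 : (Equiv.arrowCongr σ.symm (Equiv.refl ℕ)) h = h ∘ σ := by
        ext i; simp
      rw [h1]
      congr 1
      have h2 : D (h ∘ σ) = (Equiv.Perm.sign σ : ℝ) * D h := by
        have := Matrix.det_permute σ (Matrix.of fun i j => f j (h i))
        simpa [D, Matrix.submatrix] using this
      have h3 : ∏ i, f (σ i) ((h ∘ σ) i) = ∏ i, f i (h i) :=
        Equiv.prod_comp σ (fun i => f i (h i))
      have h4 : (Equiv.Perm.sign σ : ℝ) * (Equiv.Perm.sign σ : ℝ) = 1 := by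
        rcases Int.units_eq_one_or (Equiv.Perm.sign σ) with h | h <;> simp [h]
      rw [h2, h3]
      simp only [G]
      linear_combination -(∏ i, f i (h i)) * D h * h4
  rw [Finset.sum_congr rfl fun σ _ => hre σ, Finset.sum_comm]
  refine Finset.sum_congr rfl fun h _ => ?_
  split_ifs with hh
  · rw [← Finset.sum_mul, ← hD, ← sq]
  · simp

/-- By nonnegativity, convergence along one exhausting sequence of finite sets suffices; below these
are the boxes `[0, K)^L`. -/
theorem hasSum_of_tendsto_sum_of_nonneg {ι : Type*} {F : ι → ℝ} {a : ℝ} (hF : ∀ i, 0 ≤ F i)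
    {A : ℕ → Finset ι} (hA : Monotone A) (hcov : ∀ i, ∃ K, i ∈ A K)
    (hlim : Filter.Tendsto (fun K => ∑ i ∈ A K, F i) Filter.atTop (nhds a)) : HasSum F a := by
  have hmono : Monotone fun K => ∑ i ∈ A K, F i := fun K K' h =>
    Finset.sum_le_sum_of_subset_of_nonneg (hA h) fun i _ _ => hF i
  have hle : ∀ K, ∑ i ∈ A K, F i ≤ a := fun K => hmono.ge_of_tendsto hlim K
  have hex : ∀ s : Finset ι, ∃ K, s ⊆ A K := by
    intro s
    choose k hk using hcov
    exact ⟨s.sup k, fun i hi => hA (Finset.le_sup hi) (hk i)⟩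
  refine hasSum_of_isLUB_of_nonneg a hF ⟨?_, fun b hb => ?_⟩
  · rintro _ ⟨s, rfl⟩
    obtain ⟨K, hK⟩ := hex s
    exact (Finset.sum_le_sum_of_subset_of_nonneg hK fun i _ _ => hF i).trans (hle K)
  · exact le_of_tendsto' hlim fun K => hb ⟨A K, rfl⟩

/-- The Andréief identity for a Gram determinant of square summable sequences. -/
theorem hasSum_strictMono_det_sq {L : ℕ} (f : Fin L → ℕ → ℝ)
    (hf : ∀ j k, Summable fun m => f j m * f k m) :
    HasSum (fun h : Fin L → ℕ => if StrictMono h then (Matrix.of fun i j => f j (h i)).det ^ 2 else 0)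
      (Matrix.of fun j k => ∑' m, f j m * f k m).det := by
  refine hasSum_of_tendsto_sum_of_nonneg (fun h => by split_ifs <;> positivity)
    (A := fun K => Fintype.piFinset (fun _ : Fin L => Finset.range K)) ?_ ?_ ?_
  · intro K K' h
    exact Fintype.piFinset_subset _ _ fun _ => Finset.range_mono h
  · intro h
    refine ⟨Finset.univ.sup h + 1, ?_⟩
    simp only [Fintype.mem_piFinset, Finset.mem_range]
    exact fun i => Nat.lt_succ_of_le (Finset.le_sup (f := h) (Finset.mem_univ i))
  · simp only [← det_sum_mul_eq_sum_strictMono]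
    have hc : Continuous fun M : Matrix (Fin L) (Fin L) ℝ => M.det := continuous_id.matrix_det
    refine (hc.tendsto _).comp ?_
    refine tendsto_pi_nhds.2 fun j => tendsto_pi_nhds.2 fun k => ?_
    exact (hf j k).hasSum.tendsto_sum_nat

/-! ### Gram matrices: convergence and homogeneity -/

theorem entry_eq_pow_mul (x : ℝ) (s j m : ℕ) : entry x s j m = x ^ (m - j) * entry 1 s j m := by
  unfold entry
  split_ifs with h
  · rw [h.1]; simp; ring
  · simp; ring

theorem entry_eq_zero_of_lt (x : ℝ) (s : ℕ) {j m : ℕ} (h : m < j) : entry x s j m = 0 := by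
  unfold entry
  rw [if_neg (by omega), Nat.descFactorial_of_lt h]
  simp

theorem entry_add (x : ℝ) {s j : ℕ} (m : ℕ) (h : ¬ (j = 0 ∧ s ≠ 0)) :
    entry x s j (m + j) = x ^ m / m ! := by
  unfold entry
  rw [if_neg h, Nat.add_sub_cancel, mul_div_assoc]
  have h1 := Nat.factorial_mul_descFactorial (show j ≤ m + j by omega)
  rw [Nat.add_sub_cancel] at h1
  have h2 : ((m + j)! : ℝ) = m ! * (m + j).descFactorial j := by exact_mod_cast h1.symm
  have h3 : ((m + j)! : ℝ) ≠ 0 := by positivity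
  have h4 : (m ! : ℝ) ≠ 0 := by positivity
  rw [div_eq_mul_inv (x ^ m)]
  congr 1
  rw [div_eq_iff h3, h2]
  field_simp

theorem entry_nonneg {x : ℝ} (hx : 0 ≤ x) (s j m : ℕ) : 0 ≤ entry x s j m := by
  unfold entry
  split_ifs <;> positivity

/-- Since `m/(m+s) ≤ 1`, the case `s = 0` dominates all `s` at once. -/
theorem entry_le_entry_zero {x : ℝ} (hx : 0 ≤ x) (s j m : ℕ) : entry x s j m ≤ entry x 0 j m := by
  unfold entry
  by_cases h : j = 0 ∧ s ≠ 0
  · rw [if_pos h, if_neg (by simp), h.1]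
    have h1 : (0 : ℝ) < s := by exact_mod_cast Nat.pos_of_ne_zero h.2
    simp only [Nat.sub_zero, Nat.descFactorial_zero, Nat.cast_one, mul_one]
    have h2 : (0 : ℝ) < m ! := by positivity
    have h3 : (0 : ℝ) < m + s := by positivity
    rw [div_le_div_iff₀ (by positivity) h2]
    have : 0 ≤ x ^ m * m ! * s := by positivity
    nlinarith
  · rw [if_neg h, if_neg (by simp)]

theorem summable_entry (x : ℝ) (s j : ℕ) (h : ¬ (j = 0 ∧ s ≠ 0)) : Summable (entry x s j) := by
  rw [← summable_nat_add_iff j]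
  simp only [entry_add x _ h]
  exact Real.summable_pow_div_factorial x

theorem summable_entry_mul {x : ℝ} (hx : 0 ≤ x) (s j k : ℕ) :
    Summable fun m => entry x s j m * entry x s k m := by
  have h0 : Summable fun m => entry x 0 j m * entry x 0 k m :=
    ((summable_entry x 0 j (by simp)).mul_of_nonneg (summable_entry x 0 k (by simp))
      (entry_nonneg hx 0 j) (entry_nonneg hx 0 k)).comp_injective
      (i := fun m : ℕ => (m, m)) fun a b h => (Prod.mk.inj h).1
  refine h0.of_nonneg_of_le (fun m => mul_nonneg (entry_nonneg hx _ _ _) (entry_nonneg hx _ _ _))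
    fun m => ?_
  exact mul_le_mul (entry_le_entry_zero hx _ _ _) (entry_le_entry_zero hx _ _ _)
    (entry_nonneg hx _ _ _) (entry_nonneg hx _ _ _)

/-- The Gram matrix of the sequences `entry x s j`, `j < L`. -/
noncomputable def gram (x : ℝ) (s L : ℕ) : Matrix (Fin L) (Fin L) ℝ :=
  Matrix.of fun j k => ∑' m, entry x s j m * entry x s k m

theorem hasSum_entryMatrix_det_sq {x : ℝ} (hx : 0 ≤ x) (s L : ℕ) :
    HasSum (fun h : Fin L → ℕ => if StrictMono h then (entryMatrix x s h).det ^ 2 else 0)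
      (gram x s L).det :=
  hasSum_strictMono_det_sq (fun j : Fin L => entry x s j) fun _ _ => summable_entry_mul hx _ _ _

theorem det_gram_nonneg {x : ℝ} (hx : 0 ≤ x) (s L : ℕ) : 0 ≤ (gram x s L).det :=
  (hasSum_entryMatrix_det_sq hx s L).nonneg fun h => by split_ifs <;> positivity

/-- Uniformity in `s` leaves the factor `λ^s/(s!)²` to make the series over `s` converge. -/
theorem exists_det_gram_le {x : ℝ} (hx : 0 ≤ x) (L : ℕ) : ∃ C, ∀ s, (gram x s L).det ≤ C := by
  obtain ⟨B, hB⟩ : ∃ B, ∀ j k : Fin L, gram x 0 L j k ≤ B := by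
    obtain ⟨B, hB⟩ := (Set.finite_range fun p : Fin L × Fin L => gram x 0 L p.1 p.2).bddAbove
    exact ⟨B, fun j k => hB ⟨(j, k), rfl⟩⟩
  refine ⟨_, fun s => (le_abs_self _).trans
    (Matrix.det_le (abv := AbsoluteValue.abs) (x := B) fun j k => ?_)⟩
  have h0 : 0 ≤ gram x s L j k :=
    tsum_nonneg fun m => mul_nonneg (entry_nonneg hx _ _ _) (entry_nonneg hx _ _ _)
  rw [AbsoluteValue.abs_apply, abs_of_nonneg h0]
  refine le_trans ?_ (hB j k)
  refine (summable_entry_mul hx _ _ _).tsum_le_tsum (fun m => ?_) (summable_entry_mul hx _ _ _)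
  exact mul_le_mul (entry_le_entry_zero hx _ _ _) (entry_le_entry_zero hx _ _ _)
    (entry_nonneg hx _ _ _) (entry_nonneg hx _ _ _)

theorem summable_det_gram {x : ℝ} (hx : 0 ≤ x) (L : ℕ) :
    Summable fun s : ℕ => (x ^ 2) ^ s / (s ! : ℝ) ^ 2 * (gram x s L).det := by
  obtain ⟨C, hC⟩ := exists_det_gram_le hx L
  refine ((Real.summable_pow_div_factorial (x ^ 2)).mul_right C).of_nonneg_of_le
    (fun s => mul_nonneg (by positivity) (det_gram_nonneg hx s L)) fun s => ?_
  refine mul_le_mul ?_ (hC s) (det_gram_nonneg hx s L) (by positivity)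
  have h1 : (1 : ℝ) ≤ s ! := by exact_mod_cast Nat.succ_le_of_lt s.factorial_pos
  exact div_le_div_of_nonneg_left (by positivity) (by positivity) (by nlinarith)

/-- Every nonzero Leibniz term has the same degree `∑ (h i - σ i) = K` in `x`. -/
theorem det_entryMatrix_eq_pow_mul (x : ℝ) {s L K : ℕ} {h : Fin L → ℕ}
    (hK : K + ∑ i : Fin L, (i : ℕ) = ∑ i, h i) :
    (entryMatrix x s h).det = x ^ K * (entryMatrix 1 s h).det := by
  rw [← Matrix.det_transpose, ← Matrix.det_transpose (entryMatrix 1 s h), Matrix.det_apply',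
    Matrix.det_apply', Finset.mul_sum]
  refine Finset.sum_congr rfl fun σ _ => ?_
  simp only [Matrix.transpose_apply, entryMatrix, Matrix.of_apply]
  -- Where the natural-number subtraction would truncate, the entry itself vanishes.
  by_cases hσ : ∀ i, (σ i : ℕ) ≤ h i
  · have h1 : ∏ i, entry x s (σ i) (h i) = x ^ K * ∏ i, entry 1 s (σ i) (h i) := by
      rw [Finset.prod_congr rfl fun i _ => entry_eq_pow_mul x s (σ i) (h i), Finset.prod_mul_distrib,
        Finset.prod_pow_eq_pow_sum]
      congr 2
      have h2 : ∑ i, (h i - (σ i : ℕ)) + ∑ i, (σ i : ℕ) = ∑ i, h i := by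
        rw [← Finset.sum_add_distrib]
        exact Finset.sum_congr rfl fun i _ => Nat.sub_add_cancel (hσ i)
      have h3 : ∑ i, (σ i : ℕ) = ∑ i : Fin L, (i : ℕ) := Equiv.sum_comp σ (fun i => (i : ℕ))
      omega
    rw [h1]; ring
  · push Not at hσ
    obtain ⟨i, hi⟩ := hσ
    rw [Finset.prod_eq_zero (Finset.mem_univ i) (entry_eq_zero_of_lt x s hi),
      Finset.prod_eq_zero (Finset.mem_univ i) (entry_eq_zero_of_lt 1 s hi)]
    ring

/-! ### Summation over diagrams -/

/-- The Plancherel weight `λ ^ |μ| (d_μ / |μ|!)²`. -/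
noncomputable def weight (lam : ℝ) (μ : YoungDiagram) : ℝ :=
  lam ^ μ.card * ((numSYT μ : ℝ) / μ.card !) ^ 2

theorem hasSum_phiTerm {k n : ℕ} {lam a : ℝ}
    (H : HasSum (fun μ : {μ : YoungDiagram // μ.rowLen (k - 1) ≤ n} => weight lam μ.1) a) :
    HasSum (phiTerm k n lam) (Real.exp (-lam) * a) := by
  have h1 : HasSum ({μ : YoungDiagram | μ.rowLen (k - 1) ≤ n}.indicator (weight lam)) a :=
    hasSum_subtype_iff_indicator.1 H
  have h2 := (h1.tsum_fiberwise YoungDiagram.card).mul_left (Real.exp (-lam))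
  refine h2.congr_fun fun N => ?_
  have h3 : YoungDiagram.card ⁻¹' {N} = (youngDiagrams N : Set YoungDiagram) := by
    ext μ
    simp [youngDiagrams]
  rw [h3, Finset.tsum_subtype' (youngDiagrams N), phiTerm, q, Finset.mul_sum, Finset.sum_filter,
    Finset.mul_sum]
  refine Finset.sum_congr rfl fun μ hμ => ?_
  have hN : μ.card = N := by simpa [youngDiagrams] using hμ
  by_cases hP : μ.rowLen (k - 1) ≤ n
  · rw [if_pos hP, Set.indicator_of_mem (by exact hP), weight, hN]
    field_simp
  · rw [if_neg hP, Set.indicator_of_notMem (by exact hP), mul_zero]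

theorem isColumnShape_of_tail {L s : ℕ} {μ : YoungDiagram}
    (h : ∀ p, L ≤ p → μ.colLen p = if p < L + s then 1 else 0) :
    IsColumnShape L s μ.colLen μ.cells where
  anti p p' hp := μ.colLen_anti p p' hp
  mem _ _ := YoungDiagram.mem_iff_lt_colLen
  tail := h

theorem lt_colLen_iff_lt_rowLen (μ : YoungDiagram) (i j : ℕ) : i < μ.colLen j ↔ j < μ.rowLen i :=
  YoungDiagram.mem_iff_lt_colLen.symm.trans YoungDiagram.mem_iff_lt_rowLen

theorem isColumnShape_of_rowLen_zero_le {L : ℕ} {μ : YoungDiagram} (h : μ.rowLen 0 ≤ L) :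
    IsColumnShape L 0 μ.colLen μ.cells := by
  refine isColumnShape_of_tail fun p hp => ?_
  have := lt_colLen_iff_lt_rowLen μ 0 p
  rw [if_neg (by omega)]
  omega

theorem isColumnShape_of_rowLen_one_le {L : ℕ} {μ : YoungDiagram} (h : μ.rowLen 1 ≤ L) :
    IsColumnShape L (μ.rowLen 0 - L) μ.colLen μ.cells := by
  refine isColumnShape_of_tail fun p hp => ?_
  have h0 := lt_colLen_iff_lt_rowLen μ 0 p
  have h1 := lt_colLen_iff_lt_rowLen μ 1 p
  split_ifs <;> omega

theorem IsColumnShape.rowLen_le {L s : ℕ} {μ : YoungDiagram}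
    (H : IsColumnShape L s μ.colLen μ.cells) : μ.rowLen 1 ≤ L ∧ μ.rowLen 0 ≤ L + s := by
  constructor
  · have h1 := lt_colLen_iff_lt_rowLen μ 1 L
    have := H.tail L le_rfl
    split_ifs at this <;> omega
  · have h1 := lt_colLen_iff_lt_rowLen μ 0 (L + s)
    have := H.tail (L + s) (by omega)
    rw [if_neg (by omega)] at this
    omega

theorem IsColumnShape.rowLen_sub {L s : ℕ} {μ : YoungDiagram}
    (H : IsColumnShape L s μ.colLen μ.cells) : μ.rowLen 0 - L = s := by
  have h0 := H.rowLen_le.2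
  rcases s with _ | s
  · omega
  · have h1 := lt_colLen_iff_lt_rowLen μ 0 (L + s)
    have := H.tail (L + s) (by omega)
    rw [if_pos (by omega)] at this
    omega

theorem IsColumnShape.eq_of_profile_eq {L s : ℕ} {μ ν : YoungDiagram}
    (Hμ : IsColumnShape L s μ.colLen μ.cells) (Hν : IsColumnShape L s ν.colLen ν.cells)
    (h : profile L μ.colLen = profile L ν.colLen) : μ = ν := by
  have hc : ∀ p, μ.colLen p = ν.colLen p := by
    intro p
    by_cases hp : p < L
    · have := congrFun h (Fin.rev ⟨p, hp⟩)
      simp only [profile, Fin.rev_rev] at this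
      omega
    · rw [Hμ.tail p (by omega), Hν.tail p (by omega)]
  apply YoungDiagram.ext
  ext ⟨a, p⟩
  rw [Hμ.mem, Hν.mem, hc]

theorem val_le_of_strictMono {L : ℕ} {h : Fin L → ℕ} (hh : StrictMono h) :
    ∀ (k : ℕ) (hk : k < L), k ≤ h ⟨k, hk⟩
  | 0, _ => Nat.zero_le _
  | k + 1, hk => by
    have h1 := val_le_of_strictMono hh k (by omega)
    have h2 : h ⟨k, by omega⟩ < h ⟨k + 1, hk⟩ := hh (Fin.mk_lt_mk.2 (Nat.lt_succ_self k))
    omega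

/-- The inverse of passing to the profile. -/
theorem exists_isColumnShape {L s : ℕ} {h : Fin L → ℕ} (hh : StrictMono h)
    (hs : s ≠ 0 → ∀ i, h i ≠ 0) :
    ∃ μ : YoungDiagram, IsColumnShape L s μ.colLen μ.cells ∧ profile L μ.colLen = h := by
  let c : ℕ → ℕ := fun p => if hp : p < L then h (Fin.rev ⟨p, hp⟩) - (Fin.rev ⟨p, hp⟩ : Fin L)
    else if p < L + s then 1 else 0
  have hlt : ∀ p (hp : p < L), c p = h (Fin.rev ⟨p, hp⟩) - (Fin.rev ⟨p, hp⟩ : Fin L) :=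
    fun p hp => dif_pos hp
  have hge : ∀ p, L ≤ p → c p = if p < L + s then 1 else 0 := fun p hp => dif_neg (by omega)
  have hanti : Antitone c := by
    refine antitone_nat_of_succ_le fun p => ?_
    rcases lt_trichotomy (p + 1) L with hp | hp | hp
    · rw [hlt p (by omega), hlt (p + 1) hp]
      have h1 : h (Fin.rev ⟨p + 1, hp⟩) < h (Fin.rev ⟨p, by omega⟩) :=
        hh (Fin.rev_lt_rev.2 (Fin.mk_lt_mk.2 (Nat.lt_succ_self p)))
      simp only [Fin.val_rev]
      omega
    -- At the junction, a nonempty arm requires column `L - 1` to be nonempty, which is what `hs`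
    -- provides.
    · rw [hge (p + 1) hp.ge, hlt p (by omega)]
      split_ifs with h1
      · have := hs (by omega) (Fin.rev ⟨p, by omega⟩)
        simp only [Fin.val_rev]
        omega
      · omega
    · rw [hge _ (by omega), hge _ (by omega)]
      split_ifs <;> omega
  let S : Finset (ℕ × ℕ) :=
    (Finset.range (L + s)).biUnion fun p => (Finset.range (c p)).image fun a => (a, p)
  have hS : ∀ a p, (a, p) ∈ S ↔ a < c p := by
    intro a p
    simp only [S, Finset.mem_biUnion, Finset.mem_range, Finset.mem_image, Prod.mk.injEq]
    constructor
    · rintro ⟨p', _, a', h2, rfl, rfl⟩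
      exact h2
    · intro h1
      refine ⟨p, ?_, a, h1, rfl, rfl⟩
      by_contra h2
      rw [hge p (by omega), if_neg h2] at h1
      omega
  let μ : YoungDiagram := ⟨S, by
    rintro ⟨a, p⟩ ⟨a', p'⟩ hle hm
    rw [Finset.mem_coe, hS] at hm ⊢
    exact (lt_of_le_of_lt (Prod.mk_le_mk.1 hle).1 hm).trans_le (hanti (Prod.mk_le_mk.1 hle).2)⟩
  have hcol : μ.colLen = c := by
    ext p
    refine eq_of_forall_lt_iff fun a => ?_
    rw [← YoungDiagram.mem_iff_lt_colLen]
    exact hS a p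
  refine ⟨μ, ⟨hcol ▸ hanti, hcol ▸ hS, hcol ▸ hge⟩, ?_⟩
  rw [hcol]
  ext i
  have h1 := val_le_of_strictMono hh i i.2
  simp only [profile, hlt _ (Fin.rev i).2, Fin.eta, Fin.rev_rev] at h1 ⊢
  omega

theorem IsColumnShape.weight_eq {L s : ℕ} {μ : YoungDiagram}
    (H : IsColumnShape L s μ.colLen μ.cells) (hL : s ≠ 0 → L ≠ 0) (x : ℝ) :
    weight (x ^ 2) μ =
      (x ^ 2) ^ s / (s ! : ℝ) ^ 2 * (entryMatrix x s (profile L μ.colLen)).det ^ 2 := by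
  have hN : μ.card + _ = _ := H.card_add_sum
  have hK : ∑ i : Fin L, μ.colLen (Fin.rev i) + ∑ i : Fin L, (i : ℕ) =
      ∑ i, profile L μ.colLen i := by
    rw [← Finset.sum_add_distrib]; rfl
  have hcard : μ.card = ∑ i : Fin L, μ.colLen (Fin.rev i) + s := by omega
  have hd := IsColumnShape.card_increasingFilling μ.card H hL rfl
  rw [← numSYT_eq_card_increasingFilling] at hd
  rw [weight, hd, det_entryMatrix_eq_pow_mul x hK, hcard]
  have : ((∑ i : Fin L, μ.colLen (Fin.rev i) + s)! : ℝ) ≠ 0 := by positivity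
  rw [pow_add]
  field_simp
  ring

/-- Tuples that come from no diagram thus contribute nothing: the factor `m` in column `0` vanishes
at `m = 0`. -/
theorem det_entryMatrix_eq_zero {x : ℝ} {s L : ℕ} {h : Fin L → ℕ} (hs : s ≠ 0) {i : Fin L}
    (hi : h i = 0) : (entryMatrix x s h).det = 0 := by
  refine Matrix.det_eq_zero_of_row_eq_zero i fun j => ?_
  rcases hj : (j : ℕ) with _ | j' <;> simp [entryMatrix, entry, hs, hi, hj]

theorem hasSum_phiTerm_one {x : ℝ} (hx : 0 ≤ x) (n : ℕ) :
    HasSum (phiTerm 1 n (x ^ 2)) (Real.exp (-x ^ 2) * (gram x 0 n).det) := by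
  refine hasSum_phiTerm ?_
  let g : {μ : YoungDiagram // μ.rowLen (1 - 1) ≤ n} → (Fin n → ℕ) := fun μ => profile n μ.1.colLen
  have hg : Function.Injective g := fun μ ν h => Subtype.ext
    ((isColumnShape_of_rowLen_zero_le μ.2).eq_of_profile_eq (isColumnShape_of_rowLen_zero_le ν.2) h)
  refine ((hg.hasSum_iff ?_).2 (hasSum_entryMatrix_det_sq hx 0 n)).congr_fun ?_
  · intro h hh
    refine if_neg fun hmono => hh ?_
    obtain ⟨μ, hμ, rfl⟩ := exists_isColumnShape (s := 0) hmono (by simp)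
    exact ⟨⟨μ, by simpa using hμ.rowLen_le.2⟩, rfl⟩
  · intro μ
    have H := isColumnShape_of_rowLen_zero_le μ.2
    simp only [Function.comp_apply, g]
    rw [if_pos H.strictMono_profile, H.weight_eq (by simp)]
    simp

theorem hasSum_phiTerm_two {x : ℝ} (hx : 0 ≤ x) (n : ℕ) :
    HasSum (phiTerm 2 (n + 1) (x ^ 2)) (Real.exp (-x ^ 2) *
      ∑' s : ℕ, (x ^ 2) ^ s / (s ! : ℝ) ^ 2 * (gram x s (n + 1)).det) := by
  refine hasSum_phiTerm ?_
  let F : ℕ × (Fin (n + 1) → ℕ) → ℝ := fun p => (x ^ 2) ^ p.1 / (p.1 ! : ℝ) ^ 2 *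
    if StrictMono p.2 then (entryMatrix x p.1 p.2).det ^ 2 else 0
  have hF0 : 0 ≤ F := fun p => mul_nonneg (by positivity) (by split_ifs <;> positivity)
  have hfib : ∀ s, HasSum (fun h => F (s, h))
      ((x ^ 2) ^ s / (s ! : ℝ) ^ 2 * (gram x s (n + 1)).det) :=
    fun s => (hasSum_entryMatrix_det_sq hx s (n + 1)).mul_left _
  have hsum : Summable F := by
    rw [summable_prod_of_nonneg hF0]
    refine ⟨fun s => (hfib s).summable, ?_⟩
    simp only [(hfib _).tsum_eq]
    exact summable_det_gram hx (n + 1)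
  have hF : HasSum F (∑' s : ℕ, (x ^ 2) ^ s / (s ! : ℝ) ^ 2 * (gram x s (n + 1)).det) := by
    have h1 := hsum.hasSum.prod_fiberwise hfib
    rw [h1.tsum_eq]
    exact hsum.hasSum
  let g : {μ : YoungDiagram // μ.rowLen (2 - 1) ≤ n + 1} → ℕ × (Fin (n + 1) → ℕ) :=
    fun μ => (μ.1.rowLen 0 - (n + 1), profile (n + 1) μ.1.colLen)
  have hg : Function.Injective g := by
    intro μ ν h
    obtain ⟨h1, h2⟩ := Prod.mk.inj h
    have Hν := isColumnShape_of_rowLen_one_le ν.2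
    rw [← h1] at Hν
    exact Subtype.ext ((isColumnShape_of_rowLen_one_le μ.2).eq_of_profile_eq Hν h2)
  refine ((hg.hasSum_iff ?_).2 hF).congr_fun ?_
  · rintro ⟨s, h⟩ hh
    simp only [F]
    split_ifs with hmono
    · by_cases hs : s ≠ 0 → ∀ i, h i ≠ 0
      · obtain ⟨μ, hμ, rfl⟩ := exists_isColumnShape hmono hs
        exact absurd ⟨⟨μ, hμ.rowLen_le.1⟩, Prod.ext hμ.rowLen_sub rfl⟩ hh
      · push Not at hs
        obtain ⟨hs, i, hi⟩ := hs
        rw [det_entryMatrix_eq_zero hs hi]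
        simp
    · simp
  · intro μ
    have H := isColumnShape_of_rowLen_one_le μ.2
    simp only [Function.comp_apply, g, F]
    rw [if_pos H.strictMono_profile, H.weight_eq (by simp)]

/-! ### The Toeplitz matrix as a Gram matrix -/

theorem hasSum_entry_mul_pow (x : ℝ) (k : ℕ) (z : ℂ) :
    HasSum (fun m => (entry x 0 k m : ℂ) * z ^ m) (z ^ k * Complex.exp (x * z)) := by
  have h1 : HasSum (fun m => (entry x 0 k (m + k) : ℂ) * z ^ (m + k))
      (z ^ k * Complex.exp (x * z)) := by
    have h2 := (NormedSpace.expSeries_div_hasSum_exp (x * z : ℂ)).mul_left (z ^ k)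
    rw [← Complex.exp_eq_exp_ℂ] at h2
    refine h2.congr_fun fun m => ?_
    rw [entry_add x m (by simp)]
    push_cast
    ring
  rw [hasSum_nat_add_iff (f := fun m => (entry x 0 k m : ℂ) * z ^ m) k, Finset.sum_eq_zero,
    add_zero] at h1
  · exact h1
  · intro m hm
    rw [entry_eq_zero_of_lt x 0 (Finset.mem_range.1 hm)]
    simp

theorem integral_exp_I_mul_sub (m m' : ℕ) :
    ∫ θ in (0 : ℝ)..2 * Real.pi, Complex.exp (Complex.I * ((m : ℂ) - m') * θ) =
      if m = m' then 2 * Real.pi else 0 := by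
  split_ifs with h
  · subst h
    simp
  · have hc : Complex.I * ((m : ℂ) - m') ≠ 0 :=
      mul_ne_zero Complex.I_ne_zero (sub_ne_zero.2 (by exact_mod_cast h))
    rw [integral_exp_mul_complex hc]
    have : Complex.I * ((m : ℂ) - m') * ((2 * Real.pi : ℝ) : ℂ) =
        ((m - m' : ℤ) : ℂ) * (2 * Real.pi * Complex.I) := by
      push_cast; ring
    rw [this, Complex.exp_int_mul_two_pi_mul_I]
    simp

/-- The matrix entries of the weight `exp (2 x cos θ)` as a series. -/
theorem integral_exp_mul_exp_cos {x : ℝ} (hx : 0 ≤ x) (j k : ℕ) :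
    ∫ θ in (0 : ℝ)..2 * Real.pi, Complex.exp (-Complex.I * ((j : ℂ) - k) * θ) *
      (Real.exp (2 * x * Real.cos θ) : ℂ) / (2 * Real.pi) =
    ((∑' m, entry x 0 j m * entry x 0 k m : ℝ) : ℂ) := by
  -- With `z = e^{iθ}` the integrand, before division by `2π`, is `z^k e^{xz} · z̄^j e^{x z̄}`; `F`
  -- lists the terms of this double series.
  let F : ℕ × ℕ → ℝ → ℂ := fun p θ => (entry x 0 k p.1 * entry x 0 j p.2 : ℝ) *
    Complex.exp (Complex.I * ((p.1 : ℂ) - p.2) * θ)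
  have hbound : Summable fun p : ℕ × ℕ => entry x 0 k p.1 * entry x 0 j p.2 :=
    (summable_entry x 0 k (by simp)).mul_of_nonneg (summable_entry x 0 j (by simp))
      (entry_nonneg hx 0 k) (entry_nonneg hx 0 j)
  have hnorm : ∀ p θ, ‖F p θ‖ = entry x 0 k p.1 * entry x 0 j p.2 := by
    intro p θ
    have h1 : Complex.I * ((p.1 : ℂ) - p.2) * θ = ((((p.1 : ℝ) - p.2) * θ : ℝ) : ℂ) * Complex.I := by
      push_cast; ring
    simp only [F]
    rw [norm_mul, h1, Complex.norm_exp_ofReal_mul_I, mul_one, Complex.norm_real, Real.norm_eq_abs,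
      abs_of_nonneg (mul_nonneg (entry_nonneg hx _ _ _) (entry_nonneg hx _ _ _))]
  have hpoint : ∀ θ : ℝ, HasSum (fun p => F p θ)
      (Complex.exp (-Complex.I * ((j : ℂ) - k) * θ) * (Real.exp (2 * x * Real.cos θ) : ℂ)) := by
    intro θ
    have hs : Summable fun p => F p θ := by
      refine Summable.of_norm ?_
      simpa only [hnorm] using hbound
    have hF : (fun p => F p θ) = fun p : ℕ × ℕ =>
        ((entry x 0 k p.1 : ℂ) * Complex.exp (Complex.I * θ) ^ p.1) *
          ((entry x 0 j p.2 : ℂ) * Complex.exp (-(Complex.I * θ)) ^ p.2) := by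
      ext p
      rw [← Complex.exp_nat_mul, ← Complex.exp_nat_mul, mul_mul_mul_comm, ← Complex.exp_add]
      simp only [F]
      push_cast
      congr 2
      ring
    have h1 := (hasSum_entry_mul_pow x k (Complex.exp (Complex.I * θ))).mul
      (hasSum_entry_mul_pow x j (Complex.exp (-(Complex.I * θ)))) (hF ▸ hs)
    rw [hF]
    refine (congrArg (HasSum _) ?_).mpr h1
    rw [← Complex.exp_nat_mul, ← Complex.exp_nat_mul, Complex.ofReal_exp, mul_mul_mul_comm]
    simp only [← Complex.exp_add]
    congr 1
    push_cast
    rw [Complex.cos, mul_comm (θ : ℂ) Complex.I,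
      show -(θ : ℂ) * Complex.I = -(Complex.I * θ) by ring]
    ring
  have hswap := intervalIntegral.hasSum_integral_of_dominated_convergence (a := 0)
    (b := 2 * Real.pi) (μ := MeasureTheory.volume) (F := F)
    (fun p _ => entry x 0 k p.1 * entry x 0 j p.2)
    (fun p => by
      refine Continuous.aestronglyMeasurable ?_
      simp only [F]
      fun_prop)
    (fun p => Filter.Eventually.of_forall fun θ _ => (hnorm p θ).le)
    (Filter.Eventually.of_forall fun θ _ => hbound)
    (by simp)
    (Filter.Eventually.of_forall fun θ _ => hpoint θ)
  have hterm : ∀ p : ℕ × ℕ, ∫ θ in (0 : ℝ)..2 * Real.pi, F p θ =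
      (entry x 0 k p.1 * entry x 0 j p.2 : ℝ) * if p.1 = p.2 then 2 * Real.pi else 0 := by
    intro p
    simp only [F]
    rw [intervalIntegral.integral_const_mul, integral_exp_I_mul_sub]
  simp only [hterm] at hswap
  have hdiag : Function.Injective fun m : ℕ => (m, m) := fun a b h => (Prod.mk.inj h).1
  -- Orthogonality of the exponentials leaves only the diagonal.
  have h2 := (hdiag.hasSum_iff (fun p hp => by
    rw [if_neg fun h => hp ⟨p.1, Prod.ext rfl h⟩, Complex.ofReal_zero, mul_zero])).2 hswap
  rw [intervalIntegral.integral_div, ← h2.tsum_eq, Complex.ofReal_tsum, ← tsum_div_const]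
  refine tsum_congr fun m => ?_
  have hpi : (Real.pi : ℂ) ≠ 0 := by exact_mod_cast Real.pi_ne_zero
  simp only [Function.comp_apply, if_true]
  push_cast
  field_simp

theorem toeplitz_eq_map_gram {lam : ℝ} (n : ℕ) :
    toeplitz lam n = (gram √lam 0 n).map Complex.ofReal := by
  ext j k
  simpa [toeplitz, gram] using integral_exp_mul_exp_cos (Real.sqrt_nonneg lam) j k

/-! ### The bordered Toeplitz matrix and its Schur complement -/

/-- The shift removes `s`, so one Toeplitz block serves every `s`. -/
theorem entry_succ_succ (x : ℝ) (s j m : ℕ) : entry x s (j + 1) (m + 1) = entry x 0 j m := by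
  by_cases h : j ≤ m
  · obtain ⟨i, rfl⟩ := Nat.exists_eq_add_of_le' h
    rw [add_assoc, entry_add x i (by simp), entry_add x i (by simp)]
  · rw [entry_eq_zero_of_lt x s (by omega), entry_eq_zero_of_lt x 0 (by omega)]

theorem gram_succ_succ {x : ℝ} (hx : 0 ≤ x) (s n : ℕ) (j k : Fin n) :
    gram x s (n + 1) j.succ k.succ = gram x 0 n j k := by
  simp only [gram, Matrix.of_apply, Fin.val_succ]
  rw [(summable_entry_mul hx s _ _).tsum_eq_zero_add, entry_eq_zero_of_lt x s (by omega), zero_mul,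
    zero_add]
  simp only [entry_succ_succ]

theorem entry_zero_succ (x : ℝ) (s i : ℕ) :
    entry x s 0 (i + 1) = x ^ (i + 1) / (i ! * ((i : ℝ) + 1 + s)) := by
  have h1 : (i ! : ℝ) ≠ 0 := by positivity
  have h2 : (i + 1 : ℝ) ≠ 0 := by positivity
  have h3 : (i + 1 + s : ℝ) ≠ 0 := by positivity
  unfold entry
  split_ifs with h
  · rw [Nat.factorial_succ]
    push_cast
    field_simp
  · obtain rfl : s = 0 := by simpa using h
    rw [Nat.factorial_succ]
    simp only [Nat.sub_zero, Nat.descFactorial_zero]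
    push_cast
    field_simp
    ring

theorem gram_zero_zero {x : ℝ} (hx : 0 ≤ x) (s n : ℕ) :
    gram x s (n + 1) 0 0 = aZero (x ^ 2) s := by
  simp only [gram, Matrix.of_apply, Fin.val_zero, aZero]
  split_ifs with h
  · subst h
    refine tsum_congr fun m => ?_
    have := entry_add x (s := 0) (j := 0) m (by simp)
    rw [add_zero] at this
    rw [this]
    ring
  · rw [(summable_entry_mul hx s _ _).tsum_eq_zero_add]
    have h0 : entry x s 0 0 = 0 := by simp [entry, h]
    rw [h0, zero_mul, zero_add]
    refine tsum_congr fun i => ?_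
    rw [entry_zero_succ, div_mul_div_comm]
    congr 1 <;> ring

theorem gram_zero_succ {x : ℝ} (hx : 0 ≤ x) (s n : ℕ) (j : Fin n) :
    gram x s (n + 1) 0 j.succ = a (x ^ 2) (j + 1) s := by
  simp only [gram, Matrix.of_apply, Fin.val_zero, a, Fin.val_succ]
  rw [← (summable_entry_mul hx s _ _).sum_add_tsum_nat_add (j + 1), Finset.sum_eq_zero, zero_add]
  · refine tsum_congr fun i => ?_
    rw [entry_add x i (by simp), ← add_assoc, entry_zero_succ, div_mul_div_comm]
    -- The half-integer power of `λ` is `x^(2i+j+1)`, the product of the powers in the two entries.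
    have hp : (x ^ 2) ^ ((i : ℝ) + ((j + 1 : ℕ) : ℝ) / 2) = x ^ (i + j + 1) * x ^ i := by
      rw [← Real.rpow_natCast x 2, ← Real.rpow_mul hx, ← pow_add, ← Real.rpow_natCast]
      congr 1
      push_cast
      ring
    rw [hp, Nat.add_sub_cancel]
    congr 1
    push_cast
    ring
  · intro m hm
    rw [entry_eq_zero_of_lt x s (Finset.mem_range.1 hm), mul_zero]

theorem gram_comm (x : ℝ) (s n : ℕ) (j k : Fin n) : gram x s n j k = gram x s n k j :=
  tsum_congr fun _ => mul_comm _ _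

theorem det_eq_det_succ_mul_schur {n : ℕ} (M : Matrix (Fin (n + 1)) (Fin (n + 1)) ℂ)
    (D : Matrix (Fin n) (Fin n) ℂ) (hD : ∀ j k, M j.succ k.succ = D j k) (hu : IsUnit D.det) :
    M.det = D.det * (M 0 0 - (D⁻¹.mulVec fun j => M j.succ 0) ⬝ᵥ fun j => M 0 j.succ) := by
  -- Index `0` is moved last, so that `D` becomes the upper left block.
  let e : Fin (n + 1) ≃ Fin n ⊕ Unit := (finSuccEquiv n).trans (Equiv.optionEquivSumPUnit (Fin n))
  have := D.invertibleOfIsUnitDet hu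
  have h1 : M.submatrix e.symm e.symm = Matrix.fromBlocks D (Matrix.of fun j _ => M j.succ 0)
      (Matrix.of fun _ k => M 0 k.succ) (Matrix.of fun _ _ => M 0 0) := by
    ext i j
    rcases i with i | i <;> rcases j with j | j <;> simp [e, hD]
  rw [← Matrix.det_submatrix_equiv_self e.symm M, h1, Matrix.det_fromBlocks₁₁,
    Matrix.det_unique (n := Unit), Matrix.mul_assoc, Matrix.invOf_eq_nonsing_inv]
  congr 1
  simp only [Matrix.sub_apply, Matrix.of_apply, Matrix.mul_apply, Matrix.mulVec, dotProduct]
  congr 1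
  exact Finset.sum_congr rfl fun j _ => mul_comm _ _

/-- The empty diagram contributes `e^{-x²}` to a sum of nonnegative terms equal to `e^{-x²}` times
this determinant. -/
theorem det_gram_zero_pos {x : ℝ} (hx : 0 ≤ x) (n : ℕ) : 0 < (gram x 0 n).det := by
  have H := hasSum_phiTerm_one hx n
  have h0 : phiTerm 1 n (x ^ 2) 0 = Real.exp (-x ^ 2) := by simp [phiTerm, q_zero]
  have hle : phiTerm 1 n (x ^ 2) 0 ≤ Real.exp (-x ^ 2) * (gram x 0 n).det := by
    refine le_hasSum H 0 fun N _ => ?_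
    unfold phiTerm q
    exact mul_nonneg (by positivity) (Finset.sum_nonneg fun _ _ => by positivity)
  rw [h0] at hle
  have hpos := Real.exp_pos (-x ^ 2)
  by_contra hneg
  nlinarith [mul_nonpos_of_nonneg_of_nonpos hpos.le (not_lt.1 hneg)]

theorem det_toeplitz (lam : ℝ) (n : ℕ) : (toeplitz lam n).det = ((gram √lam 0 n).det : ℂ) := by
  rw [toeplitz_eq_map_gram]
  exact (RingHom.map_det Complex.ofRealHom _).symm

theorem isUnit_det_toeplitz (lam : ℝ) (n : ℕ) : IsUnit (toeplitz lam n).det := by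
  rw [det_toeplitz, isUnit_iff_ne_zero]
  exact_mod_cast (det_gram_zero_pos (Real.sqrt_nonneg lam) n).ne'

theorem bracketTerm_eq {lam : ℝ} (hlam : 0 ≤ lam) (n s : ℕ) :
    bracketTerm lam n s = ((lam ^ s / (s ! : ℝ) ^ 2 * (gram √lam s (n + 1)).det /
      (gram √lam 0 n).det : ℝ) : ℂ) := by
  have hx := Real.sqrt_nonneg lam
  have hsq := Real.sq_sqrt hlam
  have h1 := det_eq_det_succ_mul_schur ((gram √lam s (n + 1)).map Complex.ofReal) (toeplitz lam n)
    (fun j k => by simp [toeplitz_eq_map_gram, gram_succ_succ hx]) (isUnit_det_toeplitz lam n)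
  have hb : (fun j : Fin n => ((gram √lam s (n + 1)).map Complex.ofReal) 0 j.succ) = b lam n s := by
    ext j
    simp [b, gram_zero_succ hx, hsq]
  have hb' : (fun j : Fin n => ((gram √lam s (n + 1)).map Complex.ofReal) j.succ 0) = b lam n s := by
    ext j
    simp [b, gram_comm _ _ _ j.succ, gram_zero_succ hx, hsq]
  have hstar : star (b lam n s) = b lam n s := by
    ext j
    simp [b]
  have hdet : ((gram √lam s (n + 1)).map Complex.ofReal).det = ((gram √lam s (n + 1)).det : ℂ) :=
    (RingHom.map_det Complex.ofRealHom _).symm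
  rw [hb, hb', hdet, Matrix.map_apply, gram_zero_zero hx, hsq, det_toeplitz] at h1
  have hne : ((gram √lam 0 n).det : ℂ) ≠ 0 := by exact_mod_cast (det_gram_zero_pos hx n).ne'
  rw [bracketTerm, hstar]
  push_cast
  rw [h1]
  field_simp

end PlancherelSecondRow

open PlancherelSecondRow in
open scoped Nat in
theorem proposition3p1 (lam : ℝ) (hlam : 0 ≤ lam) :
    (∀ n : ℕ, Summable (phiTerm 1 n lam) ∧ Summable (phiTerm 2 (n + 1) lam)) ∧
    (∀ n : ℕ, 1 ≤ n →
      IsUnit (toeplitz lam n).det ∧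
      Summable (fun s : ℕ => bracketTerm lam n s) ∧
      (phi 2 (n + 1) lam : ℂ) = (∑' s : ℕ, bracketTerm lam n s) * (phi 1 n lam : ℂ)) ∧
    (Summable (fun s : ℕ => lam ^ s / (s ! : ℝ) ^ 2 * aZero lam s) ∧
      phi 2 1 lam = (∑' s : ℕ, lam ^ s / (s ! : ℝ) ^ 2 * aZero lam s) * phi 1 0 lam) := by
  have hx := Real.sqrt_nonneg lam
  have hsq := Real.sq_sqrt hlam
  have h1 : ∀ n, HasSum (phiTerm 1 n lam) (Real.exp (-lam) * (gram √lam 0 n).det) := fun n => by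
    simpa only [hsq] using hasSum_phiTerm_one hx n
  have h2 : ∀ n, HasSum (phiTerm 2 (n + 1) lam) (Real.exp (-lam) *
      ∑' s : ℕ, lam ^ s / (s ! : ℝ) ^ 2 * (gram √lam s (n + 1)).det) := fun n => by
    simpa only [hsq] using hasSum_phiTerm_two hx n
  have h3 : ∀ n, Summable fun s : ℕ => lam ^ s / (s ! : ℝ) ^ 2 * (gram √lam s n).det := fun n => by
    simpa only [hsq] using summable_det_gram hx n
  have h4 : ∀ s, (gram √lam s 1).det = aZero lam s := fun s => by
    rw [Matrix.det_fin_one, gram_zero_zero hx s 0, hsq]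
  refine ⟨fun n => ⟨(h1 n).summable, (h2 n).summable⟩, fun n _ => ⟨isUnit_det_toeplitz lam n, ?_, ?_⟩,
    ?_, ?_⟩
  · simp only [bracketTerm_eq hlam]
    exact Complex.ofRealCLM.summable ((h3 (n + 1)).div_const _)
  · simp only [bracketTerm_eq hlam]
    rw [← Complex.ofReal_tsum, tsum_div_const, phi, phi, (h1 n).tsum_eq, (h2 n).tsum_eq,
      ← Complex.ofReal_mul]
    congr 1
    have := (det_gram_zero_pos hx n).ne'
    field_simp
  · simpa only [h4] using h3 1
  · rw [phi, phi, (h1 0).tsum_eq, (h2 0).tsum_eq]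
    simp only [h4, Matrix.det_fin_zero]
    ring
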